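/- **Setting.** Let $\mathbb S$ be a (not necessarily commutative) semiring such that finitely generated left $\mathbb S$-semimodules are closed under kernel pairs, i.e. for every homomorphism $f\colon M\to N$ of finitely generated semimodules the semimodule $\{(x,y)\in M\times M : f(x)=f(y)\}$ is finitely generated (for example, let $\mathbb S$ be Noetherian). Let $A$ be a finite alphabet. For a semimodule $M$ put $\bar F M=\mathbb S\times M^A$ with componentwise structure, and $\bar F h=\mathrm{id}_{\mathbb S}\times h^A$ for a homomorphism $h$. An $\bar F$-coalgebra is a semimodule $M$ with a semimodule homomorphism $g\colon M\to\bar FM$; a coalgebra homomorphism from $(M,g)$ to $(N,d)$ is a semimodule homomorphism $m\colon M\to N$ with $d\circ m=\bar F m\circ g$. For a set $X$ let $VX$ be the free semimodule on $X$, consisting of the finitely supported functions $X\to\mathbb S$. **Expressions.** Over a countable supply of variables consider the expressions $E$ and the guarded expressions $E^g$ given by $$E::=x\mid \underline\emptyset\mid E\oplus E\mid \underline r\mid a.(r\cdot E)\mid \mu x.E^g,\qquad E^g::=\underline\emptyset\mid E^g\oplus E^g\mid \underline r\mid a.(r\cdot E)\mid\mu x.E^g,$$ where $r\in\mathbb S$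 and $a\in A$. Expressions are identified up to renaming of bound variables, and substitution $E[E'/x]$ is capture-avoiding. Let $\equiv_D$ be the least equivalence relation on the set of closed expressions such that * $\underline 0\equiv_D\underline\emptyset$, $\ \underline r\oplus\underline s\equiv_D\underline{r+s}$, and $\oplus$ is associative and commutative with neutral element $\underline\emptyset$; * $a.(0\cdot E)\equiv_D\underline\emptyset$ and $a.(r\cdot E)\oplus a.(s\cdot E)\equiv_D a.((r+s)\cdot E)$; * $\mu x.E\equiv_D E[\mu x.E/x]$; * if $E_1\equiv_D E_2[E_1/x]$, where $E_2$ is guarded, then $E_1\equiv_D\mu x.E_2$; * if $E_1\equiv_D E_2$ then $E[E_1/x]\equiv_D E[E_2/x]$; * $a.(r\cdot(E_1\oplus E_2))\equiv_D a.(r\cdot E_1)\oplus a.(r\cdot E_2)$, $\ a.(r\cdot b.(s\cdot E))\equiv_D a.((rs)\cdot b.(1\cdot E))$, $\ a.(r\cdot\underline s)\equiv_D a.(1\cdot\underline{rs})$, $\ a.(r\cdot\underline\emptyset)\equiv_D\underline\emptyset$. **The expression coalgebra.** Let $E_D$ be the set of closed expressions modulo $\equiv_D$. It is an $\mathbb S$-semimodule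 with $[E_1]+[E_2]=[E_1\oplus E_2]$, zero $[\underline\emptyset]$, and the scalar action determined by distributivity over sums together with $r[\underline\emptyset]=[\underline\emptyset]$, $r[\underline s]=[\underline{rs}]$, $r[a.(s\cdot E)]=[a.((rs)\cdot E)]$ and $r[\mu x.E]=r[E[\mu x.E/x]]$. It carries the coalgebra structure $c\colon E_D\to\mathbb S\times E_D^A$, the semimodule homomorphism determined by $c[\underline s]=(s,0)$ and $c[a.(s\cdot E)]=(0,f)$, where $f(a)=s[E]$ and $f(b)=0$ for $b\ne a$. **Theorem.** For every $\bar F$-coalgebra $(VS,g)$ with $S$ a finite set there exists a unique coalgebra homomorphism from $(VS,g)$ to $(E_D,c)$. -/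

import Mathlib

universe u v w w'

namespace WeightedCalculus

/-- Syntactic expressions over a semiring `R` and an alphabet `A`, up to renaming of bound variables
(well-scoped de Bruijn indices: the number is the number of variables that may occur free, and
`mu` binds the variable `0` of its body).  `Ex R A false n` is the class `E` of all expressions
`E  ::= x | 0 | E ⊕ E | r | a.(r • E) | μx.Eᵍ`, and `Ex R A true n` is the class `Eᵍ` of guarded ones
`Eᵍ ::= 0 | Eᵍ ⊕ Eᵍ | r | a.(r • E) | μx.Eᵍ`. -/
inductive Ex (R : Type u) (A : Type v) : Bool → ℕ → Type (max u v)
  | var {n : ℕ} (i : Fin n) : Ex R A false n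
  | zero {b : Bool} {n : ℕ} : Ex R A b n
  | add {b : Bool} {n : ℕ} (E₁ E₂ : Ex R A b n) : Ex R A b n
  | const {b : Bool} {n : ℕ} (r : R) : Ex R A b n
  | pre {b : Bool} {n : ℕ} (a : A) (r : R) (E : Ex R A false n) : Ex R A b n
  | mu {b : Bool} {n : ℕ} (E : Ex R A true (n + 1)) : Ex R A b n

/-- The set `Exp` of closed expressions. -/
abbrev ClosedExp (R : Type u) (A : Type v) : Type (max u v) := Ex R A false 0

namespace Ex

variable {R : Type u} {A : Type v}

/-- Every guarded expression is an expression. -/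
def toEx : {b : Bool} → {n : ℕ} → Ex R A b n → Ex R A false n
  | _, _, var i => var i
  | _, _, zero => zero
  | _, _, add E₁ E₂ => add E₁.toEx E₂.toEx
  | _, _, const r => const r
  | _, _, pre a r E => pre a r E
  | _, _, mu E => mu E

/-- Extend a map of variables under a binder. -/
def liftRen {n m : ℕ} (ρ : Fin n → Fin m) : Fin (n + 1) → Fin (m + 1) :=
  Fin.cases 0 fun i => (ρ i).succ

/-- Renaming of free variables. -/
def ren : {b : Bool} → {n m : ℕ} → (Fin n → Fin m) → Ex R A b n → Ex R A b m
  | _, _, _, ρ, var i => var (ρ i)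
  | _, _, _, _, zero => zero
  | _, _, _, ρ, add E₁ E₂ => add (E₁.ren ρ) (E₂.ren ρ)
  | _, _, _, _, const r => const r
  | _, _, _, ρ, pre a r E => pre a r (E.ren ρ)
  | _, _, _, ρ, mu E => mu (E.ren (liftRen ρ))

/-- Extend a substitution under a binder. -/
def liftSub {n m : ℕ} (σ : Fin n → Ex R A false m) : Fin (n + 1) → Ex R A false (m + 1) :=
  Fin.cases (var 0) fun i => (σ i).ren Fin.succ

/-- Simultaneous capture-avoiding substitution for the free variables. -/
def subst : {b : Bool} → {n m : ℕ} → (Fin n → Ex R A false m) → Ex R A b n → Ex R A b m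
  | _, _, _, σ, var i => (σ i)
  | _, _, _, _, zero => zero
  | _, _, _, σ, add E₁ E₂ => add (E₁.subst σ) (E₂.subst σ)
  | _, _, _, _, const r => const r
  | _, _, _, σ, pre a r E => pre a r (E.subst σ)
  | _, _, _, σ, mu E => mu (E.subst (liftSub σ))

/-- `E.inst E'` is the substitution `E[E'/x]`, where `x` is the variable `0` of `E`. -/
def inst {b : Bool} {n : ℕ} (E : Ex R A b (n + 1)) (E' : Ex R A false n) : Ex R A b n :=
  E.subst (Fin.cases E' var)

end Ex

open Ex

/-- The relation `≡_D`: the least equivalence on closed expressions generated by the rules. -/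
inductive EqvD {R : Type u} [Semiring R] {A : Type v} : ClosedExp R A → ClosedExp R A → Prop
  | refl (E : ClosedExp R A) : EqvD E E
  | symm {E₁ E₂ : ClosedExp R A} : EqvD E₁ E₂ → EqvD E₂ E₁
  | trans {E₁ E₂ E₃ : ClosedExp R A} : EqvD E₁ E₂ → EqvD E₂ E₃ → EqvD E₁ E₃
  | const_zero : EqvD (const 0) zero
  | const_add (r s : R) : EqvD (add (const r) (const s)) (const (r + s))
  | zero_add (E : ClosedExp R A) : EqvD (add zero E) E
  | add_comm (E₁ E₂ : ClosedExp R A) : EqvD (add E₁ E₂) (add E₂ E₁)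
  | add_assoc (E₁ E₂ E₃ : ClosedExp R A) :
      EqvD (add (add E₁ E₂) E₃) (add E₁ (add E₂ E₃))
  | pre_zero (a : A) (E : ClosedExp R A) : EqvD (pre a 0 E) zero
  | pre_add (a : A) (r s : R) (E : ClosedExp R A) :
      EqvD (add (pre a r E) (pre a s E)) (pre a (r + s) E)
  /-- The fixpoint axiom `μx.E ≡ E[μx.E/x]`. -/
  | fix (E : Ex R A true 1) : EqvD (mu E) (E.inst (mu E)).toEx
  /-- The uniqueness rule: `E₁ ≡ E₂[E₁/x]` implies `E₁ ≡ μx.E₂`. -/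
  | unique {E₁ : ClosedExp R A} {E₂ : Ex R A true 1} :
      EqvD E₁ (E₂.inst E₁).toEx → EqvD E₁ (mu E₂)
  /-- The replacement rule: `E₁ ≡ E₂` implies `E[E₁/x] ≡ E[E₂/x]`. -/
  | repl {E₁ E₂ : ClosedExp R A} (E : Ex R A false 1) :
      EqvD E₁ E₂ → EqvD (E.inst E₁) (E.inst E₂)
  | pre_sum (a : A) (r : R) (E₁ E₂ : ClosedExp R A) :
      EqvD (pre a r (add E₁ E₂)) (add (pre a r E₁) (pre a r E₂))
  | pre_pre (a b : A) (r s : R) (E : ClosedExp R A) :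
      EqvD (pre a r (pre b s E)) (pre a (r * s) (pre b 1 E))
  | pre_const (a : A) (r s : R) : EqvD (pre a r (const s)) (pre a 1 (const (r * s)))
  | pre_nil (a : A) (r : R) : EqvD (pre a r zero) zero

/-- The setoid of `≡_D`. -/
instance eqvDSetoid (R : Type u) [Semiring R] (A : Type v) : Setoid (ClosedExp R A) :=
  ⟨EqvD, EqvD.refl, EqvD.symm, EqvD.trans⟩

/-- The set `E_D` of closed expressions modulo `≡_D`. -/
def ED (R : Type u) [Semiring R] (A : Type v) : Type (max u v) := Quotient (eqvDSetoid R A)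

/-- The class of a closed expression in `E_D`. -/
def cls {R : Type u} [Semiring R] {A : Type v} (E : ClosedExp R A) : ED R A := Quotient.mk _ E

namespace Ex

variable {R : Type u} [Semiring R] {A : Type v}

/-- The scalar action of the semiring on expressions, with `s(μx.E) = s(E[μx.E/x])`, written here
as `(sE)[μx.E/x]` so that the recursion is structural (see `smul_mu` for the former equation).
The value at a variable is irrelevant: it is never reached from a closed or a guarded expression. -/
def smul (s : R) : {b : Bool} → {n : ℕ} → Ex R A b n → Ex R A false n
  | _, _, var i => var i
  | _, _, zero => zero
  | _, _, add E₁ E₂ => add (smul s E₁) (smul s E₂)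
  | _, _, const r => const (s * r)
  | _, _, pre a r E => pre a (s * r) E
  | _, _, mu E => (smul s E).inst (mu E)

open Classical in
/-- The weighted automaton structure on expressions: the output weight of an expression and, for
each letter, a formal linear combination of expressions.  It satisfies
`step (μx.E) = step (E[μx.E/x])` (see `step_mu`); the equation for `mu` is written with the
substitution outside so that the recursion is structural.
The value at a variable is irrelevant: it is never reached from a closed or a guarded expression. -/
noncomputable def step : {b : Bool} → {n : ℕ} → Ex R A b n → R × (A → (Ex R A false n →₀ R))
  | _, _, var _ => 0
  | _, _, zero => 0
  | _, _, add E₁ E₂ => step E₁ + step E₂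
  | _, _, const r => (r, 0)
  | _, _, pre a r E => (0, Pi.single a (Finsupp.single E r))
  | _, _, mu E => ((step E).1, fun a => ((step E).2 a).mapDomain fun F => F.inst (mu E))

end Ex

/-! ### Substitution lemmas -/

namespace Ex

variable {R : Type u} {A : Type v}

theorem ren_ren {b : Bool} {n m k : ℕ} (ρ : Fin n → Fin m) (τ : Fin m → Fin k) (E : Ex R A b n) :
    (E.ren ρ).ren τ = E.ren (τ ∘ ρ) := by
  induction E generalizing m k with
  | var i => rfl
  | zero => rfl
  | const r => rfl
  | add E₁ E₂ h₁ h₂ => simp [ren, h₁, h₂]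
  | pre a r E h => simp [ren, h]
  | mu E h =>
    simp only [ren, h]
    congr 2
    funext i
    refine Fin.cases ?_ (fun i => ?_) i <;> simp [liftRen]

theorem ren_subst {b : Bool} {n m k : ℕ} (ρ : Fin n → Fin m) (σ : Fin m → Ex R A false k)
    (E : Ex R A b n) : (E.ren ρ).subst σ = E.subst (σ ∘ ρ) := by
  induction E generalizing m k with
  | var i => rfl
  | zero => rfl
  | const r => rfl
  | add E₁ E₂ h₁ h₂ => simp [ren, subst, h₁, h₂]
  | pre a r E h => simp [ren, subst, h]
  | mu E h =>
    simp only [ren, subst, h]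
    congr 2
    funext i
    refine Fin.cases ?_ (fun i => ?_) i <;> simp [liftRen, liftSub]

theorem subst_ren {b : Bool} {n m k : ℕ} (σ : Fin n → Ex R A false m) (ρ : Fin m → Fin k)
    (E : Ex R A b n) : (E.subst σ).ren ρ = E.subst fun i => (σ i).ren ρ := by
  induction E generalizing m k with
  | var i => rfl
  | zero => rfl
  | const r => rfl
  | add E₁ E₂ h₁ h₂ => simp [ren, subst, h₁, h₂]
  | pre a r E h => simp [ren, subst, h]
  | mu E h =>
    simp only [ren, subst, h]
    congr 2
    funext i
    refine Fin.cases ?_ (fun i => ?_) i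
    · simp [liftRen, liftSub, ren]
    · simp only [liftSub, Fin.cases_succ, ren_ren]
      rfl

theorem subst_subst {b : Bool} {n m k : ℕ} (σ : Fin n → Ex R A false m)
    (τ : Fin m → Ex R A false k) (E : Ex R A b n) :
    (E.subst σ).subst τ = E.subst fun i => (σ i).subst τ := by
  induction E generalizing m k with
  | var i => rfl
  | zero => rfl
  | const r => rfl
  | add E₁ E₂ h₁ h₂ => simp [subst, h₁, h₂]
  | pre a r E h => simp [subst, h]
  | mu E h =>
    simp only [subst, h]
    congr 2
    funext i
    refine Fin.cases ?_ (fun i => ?_) i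
    · simp [liftSub, subst]
    · simp only [liftSub, Fin.cases_succ, ren_subst, subst_ren]
      rfl

theorem subst_var {b : Bool} {n : ℕ} (E : Ex R A b n) : E.subst var = E := by
  induction E with
  | var i => rfl
  | zero => rfl
  | const r => rfl
  | add E₁ E₂ h₁ h₂ => simp [subst, h₁, h₂]
  | pre a r E h => simp [subst, h]
  | mu E h =>
    have e : ∀ k : ℕ, liftSub (var : Fin k → Ex R A false k) = var := fun k => by
      funext i
      refine Fin.cases ?_ (fun i => ?_) i <;> simp [liftSub, ren]
    simp only [subst, e, h]

theorem subst_inst {b : Bool} {n m : ℕ} (σ : Fin n → Ex R A false m) (E : Ex R A b (n + 1))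
    (E' : Ex R A false n) :
    (E.inst E').subst σ = E.subst (Fin.cases (E'.subst σ) σ) := by
  rw [inst, subst_subst]
  congr 1
  funext i
  refine Fin.cases ?_ (fun i => ?_) i <;> simp [subst]

theorem inst_subst {b : Bool} {n m : ℕ} (σ : Fin n → Ex R A false m) (E : Ex R A b (n + 1))
    (E' : Ex R A false m) :
    (E.subst (liftSub σ)).inst E' = E.subst (Fin.cases E' σ) := by
  rw [inst, subst_subst]
  congr 1
  funext i
  refine Fin.cases ?_ (fun i => ?_) i
  · simp [liftSub, subst]
  · simp only [liftSub, Fin.cases_succ, ren_subst]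
    exact subst_var _

theorem subst_inst_comm {b : Bool} {n m : ℕ} (σ : Fin n → Ex R A false m)
    (E : Ex R A b (n + 1)) (E' : Ex R A false n) :
    (E.inst E').subst σ = (E.subst (liftSub σ)).inst (E'.subst σ) := by
  rw [subst_inst, inst_subst]

/-- A weakened closed expression is not changed by substitution. -/
theorem ren_inst (E E' : ClosedExp R A) : (E.ren (Fin.succ : Fin 0 → Fin 1)).inst E' = E := by
  rw [inst, ren_subst]
  exact subst_var _

theorem toEx_self : ∀ {n : ℕ} (E : Ex R A false n), E.toEx = E
  | _, var _ => rfl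
  | _, zero => rfl
  | _, add E₁ E₂ => congrArg₂ add (toEx_self E₁) (toEx_self E₂)
  | _, const _ => rfl
  | _, pre _ _ _ => rfl
  | _, mu _ => rfl

theorem toEx_subst {b : Bool} {n m : ℕ} (σ : Fin n → Ex R A false m) (E : Ex R A b n) :
    E.toEx.subst σ = (E.subst σ).toEx := by
  induction E with
  | var i => exact (toEx_self _).symm
  | add E₁ E₂ h₁ h₂ => simp [toEx, subst, h₁, h₂]
  | _ => rfl

variable [Semiring R]

theorem smul_toEx (s : R) {b : Bool} {n : ℕ} (E : Ex R A b n) : smul s E.toEx = smul s E := by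
  induction E with
  | add E₁ E₂ h₁ h₂ => simp [toEx, smul, h₁, h₂]
  | _ => rfl

theorem step_toEx {b : Bool} {n : ℕ} (E : Ex R A b n) : step E.toEx = step E := by
  induction E with
  | add E₁ E₂ h₁ h₂ => simp [toEx, step, h₁, h₂]
  | _ => rfl

theorem smul_subst (s : R) {n m : ℕ} (σ : Fin n → Ex R A false m) (E : Ex R A true n) :
    smul s (E.subst σ) = (smul s E).subst σ := by
  have key : ∀ {b : Bool} {n : ℕ} (E : Ex R A b n), b = true → ∀ {m : ℕ}
      (σ : Fin n → Ex R A false m), smul s (E.subst σ) = (smul s E).subst σ := by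
    intro b n E
    induction E with
    | var i => intro h; cases h
    | add E₁ E₂ h₁ h₂ => intro h m σ; simp [subst, smul, h₁ h, h₂ h]
    | mu E h =>
      intro _ m σ
      simp only [subst, smul, h rfl, subst_inst_comm]
    | _ => intro _ m σ; rfl
  exact key E rfl σ

theorem step_subst {n m : ℕ} (σ : Fin n → Ex R A false m) (E : Ex R A true n) :
    step (E.subst σ) = ((step E).1, fun a => ((step E).2 a).mapDomain fun F => F.subst σ) := by
  have key : ∀ {b : Bool} {n : ℕ} (E : Ex R A b n), b = true → ∀ {m : ℕ}
      (σ : Fin n → Ex R A false m), step (E.subst σ) =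
        ((step E).1, fun a => ((step E).2 a).mapDomain fun F => F.subst σ) := by
    classical
    intro b n E
    induction E with
    | var i => intro h; cases h
    | zero => intro _ m σ; ext <;> simp [subst, step]
    | const r => intro _ m σ; ext <;> simp [subst, step]
    | add E₁ E₂ h₁ h₂ =>
      intro h m σ
      simp only [subst, step, h₁ h, h₂ h]
      refine Prod.ext rfl (funext fun a => ?_)
      simp [Finsupp.mapDomain_add]
    | pre a r E _ =>
      intro _ m σ
      simp only [subst, step]
      refine Prod.ext rfl (funext fun c => ?_)
      by_cases hc : c = a
      · subst hc; simp [Finsupp.mapDomain_single]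
      · simp [Pi.single_eq_of_ne hc]
    | mu E h =>
      intro _ m σ
      simp only [subst, step, h rfl]
      refine Prod.ext rfl (funext fun c => ?_)
      simp only [← Finsupp.mapDomain_comp]
      congr 1
      funext F
      exact (subst_inst_comm σ F (mu E)).symm
  exact key E rfl σ

theorem smul_mu (s : R) {b : Bool} {n : ℕ} (E : Ex R A true (n + 1)) :
    smul s (mu E : Ex R A b n) = smul s (E.inst (mu E)) := (smul_subst s _ E).symm

theorem step_mu {b : Bool} {n : ℕ} (E : Ex R A true (n + 1)) :
    step (mu E : Ex R A b n) = step (E.inst (mu E)) := (step_subst _ E).symm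

end Ex

/-! ### The semimodule `E_D` -/

section

variable {R : Type u} [Semiring R] {A : Type v}

theorem EqvD.add_congr {E₁ E₁' E₂ E₂' : ClosedExp R A} (h₁ : EqvD E₁ E₁') (h₂ : EqvD E₂ E₂') :
    EqvD (add E₁ E₂) (add E₁' E₂') := by
  have key : ∀ {E E' : ClosedExp R A} (F : ClosedExp R A), EqvD E E' →
      EqvD (add E F) (add E' F) := by
    intro E E' F h
    have h' := EqvD.repl (add (var 0) (F.ren Fin.succ)) h
    have e : ∀ G : ClosedExp R A,
        (add (var 0) (F.ren Fin.succ) : Ex R A false 1).inst G = add G F := fun G =>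
      congrArg (add G) (ren_inst F G)
    rwa [e, e] at h'
  exact (key E₂ h₁).trans ((EqvD.add_comm _ _).trans ((key E₁' h₂).trans (EqvD.add_comm _ _)))

theorem EqvD.pre_congr {E E' : ClosedExp R A} (a : A) (r : R) (h : EqvD E E') :
    EqvD (pre a r E) (pre a r E') := EqvD.repl (pre a r (var 0)) h

theorem smul_repl (s : R) {E₁ E₂ : ClosedExp R A} (h : EqvD E₁ E₂)
    (ih : EqvD (smul s E₁) (smul s E₂)) : ∀ E : Ex R A false 1,
      EqvD (smul s (E.inst E₁)) (smul s (E.inst E₂))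
  | var i => by
    have : i = 0 := Subsingleton.elim _ _
    subst this
    exact ih
  | zero => EqvD.refl _
  | const _ => EqvD.refl _
  | add F₁ F₂ => (smul_repl s h ih F₁).add_congr (smul_repl s h ih F₂)
  | pre a r F => EqvD.repl (pre a (s * r) F) h
  | mu F => by
    have e : ∀ G : ClosedExp R A,
        smul s ((mu F : Ex R A false 1).inst G) = (smul s (mu F : Ex R A true 1)).inst G :=
      fun G => by
        change smul s ((mu F : Ex R A true 1).inst G) = _
        rw [inst, smul_subst, inst]
    rw [e, e]
    exact EqvD.repl _ h

theorem EqvD.smul_congr (s : R) {E E' : ClosedExp R A} (h : EqvD E E') :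
    EqvD (smul s E) (smul s E') := by
  induction h with
  | refl E => exact .refl _
  | symm _ ih => exact ih.symm
  | trans _ _ ih₁ ih₂ => exact ih₁.trans ih₂
  | const_zero => simpa [smul] using EqvD.const_zero
  | const_add r t => simpa [smul, mul_add] using EqvD.const_add (s * r) (s * t)
  | zero_add E => exact .zero_add _
  | add_comm => exact .add_comm _ _
  | add_assoc => exact .add_assoc _ _ _
  | pre_zero a E => simpa [smul] using EqvD.pre_zero a E
  | pre_add a r t E => simpa [smul, mul_add] using EqvD.pre_add a (s * r) (s * t) E
  | fix E => rw [smul_toEx, ← smul_mu]; exact .refl _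
  | @unique E₁ E₂ h ih =>
    refine ih.trans ?_
    have e : ∀ G : ClosedExp R A, smul s (E₂.inst G).toEx = (smul s E₂).inst G := fun G => by
      rw [smul_toEx]; exact smul_subst s _ E₂
    rw [e]
    exact EqvD.repl _ (EqvD.unique h)
  | repl E h ih => exact smul_repl s h ih E
  | pre_sum a r E₁ E₂ => exact .pre_sum _ _ _ _
  | pre_pre a b r t E => simpa [smul, mul_assoc] using EqvD.pre_pre a b (s * r) t E
  | pre_const a r t =>
    refine (EqvD.pre_const a (s * r) t).trans ?_
    simpa [smul, mul_assoc] using (EqvD.pre_const a s (r * t)).symm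
  | pre_nil a r => exact .pre_nil _ _

/-- Addition in `E_D` is `[E₁] + [E₂] = [E₁ ⊕ E₂]`. -/
instance : Add (ED R A) := ⟨Quotient.map₂ add fun _ _ h₁ _ _ h₂ => EqvD.add_congr h₁ h₂⟩

instance : Zero (ED R A) := ⟨cls zero⟩

/-- The scalar action on `E_D` is `r[E] = [rE]`. -/
instance : SMul R (ED R A) := ⟨fun s => Quotient.map (smul s) fun _ _ h => EqvD.smul_congr s h⟩

theorem cls_eq {E E' : ClosedExp R A} (h : EqvD E E') : cls E = cls E' := Quotient.sound h

/-- Induction on the complexity of expressions. -/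
theorem ED.ind {P : ED R A → Prop} (hz : P (cls zero)) (hc : ∀ r, P (cls (const r)))
    (hp : ∀ a r E, P (cls (pre a r E))) (ha : ∀ x y, P x → P y → P (x + y)) (x : ED R A) : P x := by
  have key : ∀ {b : Bool} {n : ℕ} (E : Ex R A b n), b = true → ∀ (σ : Fin n → ClosedExp R A),
      P (cls (E.subst σ).toEx) := by
    intro b n E
    induction E with
    | var i => intro h; cases h
    | zero => intro _ _; exact hz
    | const r => intro _ _; exact hc r
    | pre a r E _ => intro _ _; exact hp _ _ _
    | add E₁ E₂ h₁ h₂ => intro h σ; exact ha _ _ (h₁ h σ) (h₂ h σ)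
    | mu E h =>
      intro _ σ
      have h' := h rfl (Fin.cases (mu (E.subst (liftSub σ))) σ)
      rw [← inst_subst] at h'
      have e := cls_eq (EqvD.fix (E.subst (liftSub σ)))
      rw [← e] at h'
      exact h'
  have closed : ∀ E : ClosedExp R A, P (cls E) := by
    let rec go : ∀ E : ClosedExp R A, P (cls E)
      | zero => hz
      | const r => hc r
      | pre a r E => hp a r E
      | add E₁ E₂ => ha _ _ (go E₁) (go E₂)
      | mu E => by
        have h := key (mu E : Ex R A true 0) rfl var
        rw [subst_var] at h
        exact h
    exact go
  exact Quotient.ind closed x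

instance : AddCommMonoid (ED R A) where
  add_assoc x y z := Quotient.inductionOn₃ x y z fun _ _ _ => cls_eq (.add_assoc _ _ _)
  zero_add x := Quotient.inductionOn x fun _ => cls_eq (.zero_add _)
  add_zero x := Quotient.inductionOn x fun _ => cls_eq ((EqvD.add_comm _ _).trans (.zero_add _))
  add_comm x y := Quotient.inductionOn₂ x y fun _ _ => cls_eq (.add_comm _ _)
  nsmul := nsmulRec

theorem ED.zero_eq : cls (zero : ClosedExp R A) = 0 := rfl

theorem ED.smul_const (s r : R) : s • cls (const r : ClosedExp R A) = cls (const (s * r)) := rfl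

theorem ED.smul_pre (s : R) (a : A) (r : R) (E : ClosedExp R A) :
    s • cls (pre a r E) = cls (pre a (s * r) E) := rfl

theorem ED.smul_sum (s : R) (x y : ED R A) : s • (x + y) = s • x + s • y :=
  Quotient.inductionOn₂ x y fun _ _ => rfl

theorem ED.smul_nil (s : R) : s • (0 : ED R A) = 0 := rfl

/-- `E_D` is a semimodule. -/
instance : Module R (ED R A) where
  smul_zero := ED.smul_nil
  smul_add := ED.smul_sum
  one_smul x := by
    induction x using ED.ind with
    | hz => rfl
    | hc r => simp [ED.smul_const]
    | hp a r E => simp [ED.smul_pre]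
    | ha x y hx hy => rw [ED.smul_sum, hx, hy]
  mul_smul r s x := by
    induction x using ED.ind with
    | hz => rfl
    | hc t => simp [ED.smul_const, mul_assoc]
    | hp a t E => simp [ED.smul_pre, mul_assoc]
    | ha x y hx hy => simp only [ED.smul_sum, hx, hy]
  add_smul r s x := by
    induction x using ED.ind with
    | hz => exact (add_zero (0 : ED R A)).symm
    | hc t =>
      simp only [ED.smul_const, add_mul]
      exact (cls_eq (EqvD.const_add _ _)).symm
    | hp a t E =>
      simp only [ED.smul_pre, add_mul]
      exact (cls_eq (EqvD.pre_add _ _ _ _)).symm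
    | ha x y hx hy => simp only [ED.smul_sum, hx, hy]; exact add_add_add_comm _ _ _ _
  zero_smul x := by
    induction x using ED.ind with
    | hz => rfl
    | hc t => simp only [ED.smul_const, zero_mul]; exact cls_eq EqvD.const_zero
    | hp a t E => simp only [ED.smul_pre, zero_mul]; exact cls_eq (EqvD.pre_zero _ _)
    | ha x y hx hy => rw [ED.smul_sum, hx, hy]; exact add_zero _

end

/-! ### Coalgebras for the lifted functor -/

/-- The functor `F̄ M = R × M^A` on `R`-semimodules (with the componentwise structure). -/
abbrev Fbar (R : Type u) (A : Type v) (M : Type w) : Type (max u v w) := R × (A → M)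

/-- The action of `F̄` on homomorphisms: `(r, (m_a)) ↦ (r, (f m_a))`. -/
def Fbar.map {R : Type u} [Semiring R] (A : Type v) {M : Type w} {N : Type w'} [AddCommMonoid M]
    [Module R M] [AddCommMonoid N] [Module R N] (f : M →ₗ[R] N) :
    Fbar R A M →ₗ[R] Fbar R A N :=
  LinearMap.prodMap LinearMap.id (f.compLeft A)

/-- A semimodule homomorphism `h` is a homomorphism of `F̄`-coalgebras from `(M, c)` to `(N, d)`
if `d ∘ h = F̄ h ∘ c`. -/
def IsCoalgHom {R : Type u} [Semiring R] {A : Type v} {M : Type w} {N : Type w'} [AddCommMonoid M]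
    [Module R M] [AddCommMonoid N] [Module R N] (c : M →ₗ[R] Fbar R A M) (d : N →ₗ[R] Fbar R A N)
    (h : M →ₗ[R] N) : Prop :=
  d ∘ₗ h = Fbar.map A h ∘ₗ c

section

variable {R : Type u} [Semiring R] {A : Type v}

/-- Evaluate the formal linear combinations in `step E` in the semimodule `E_D`. -/
noncomputable def stepD (E : ClosedExp R A) : Fbar R A (ED R A) :=
  ((step E).1, fun a => Finsupp.linearCombination R cls ((step E).2 a))

theorem stepD_zero : stepD (zero : ClosedExp R A) = 0 := by
  ext <;> simp [stepD, step]

theorem stepD_const (r : R) : stepD (const r : ClosedExp R A) = (r, 0) := by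
  ext <;> simp [stepD, step]

open Classical in
theorem stepD_pre (a : A) (r : R) (E : ClosedExp R A) :
    stepD (pre a r E) = (0, Pi.single a (r • cls E)) := by
  refine Prod.ext rfl (funext fun b => ?_)
  by_cases hb : b = a
  · subst hb; simp [stepD, step]
  · simp [stepD, step, Pi.single_eq_of_ne hb]

theorem stepD_add (E₁ E₂ : ClosedExp R A) : stepD (add E₁ E₂) = stepD E₁ + stepD E₂ := by
  ext <;> simp [stepD, step]

theorem stepD_inst {E₁ E₂ : ClosedExp R A} (h : EqvD E₁ E₂) (E : Ex R A true 1) :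
    stepD (E.inst E₁).toEx = stepD (E.inst E₂).toEx := by
  have e : ∀ G : ClosedExp R A, stepD (E.inst G).toEx =
      ((step E).1, fun a =>
        Finsupp.linearCombination R (fun F => cls (F.inst G)) ((step E).2 a)) := by
    intro G
    simp only [stepD, step_toEx, inst, step_subst, Finsupp.linearCombination_mapDomain]
    rfl
  rw [e, e]
  have : (fun F : Ex R A false 1 => cls (F.inst E₁)) = fun F => cls (F.inst E₂) :=
    funext fun F => cls_eq (EqvD.repl F h)
  rw [this]

theorem stepD_repl {E₁ E₂ : ClosedExp R A} (h : EqvD E₁ E₂) (ih : stepD E₁ = stepD E₂) :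
    ∀ E : Ex R A false 1, stepD (E.inst E₁) = stepD (E.inst E₂)
  | var i => by
    have : i = 0 := Subsingleton.elim _ _
    subst this
    exact ih
  | zero => rfl
  | const _ => rfl
  | add F₁ F₂ => by
    have h₁ := stepD_repl h ih F₁
    have h₂ := stepD_repl h ih F₂
    change stepD (add (F₁.inst E₁) (F₂.inst E₁)) = stepD (add (F₁.inst E₂) (F₂.inst E₂))
    rw [stepD_add, stepD_add, h₁, h₂]
  | pre a r F => stepD_inst h (pre a r F)
  | mu F => stepD_inst h (mu F)

theorem stepD_congr {E E' : ClosedExp R A} (h : EqvD E E') : stepD E = stepD E' := by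
  classical
  induction h with
  | refl E => rfl
  | symm _ ih => exact ih.symm
  | trans _ _ ih₁ ih₂ => exact ih₁.trans ih₂
  | const_zero => rw [stepD_const, stepD_zero]; rfl
  | const_add r t => simp [stepD_add, stepD_const]
  | zero_add E => simp [stepD_add, stepD_zero]
  | add_comm => rw [stepD_add, stepD_add, add_comm]
  | add_assoc => simp only [stepD_add, add_assoc]
  | pre_zero a E => simp [stepD_pre, stepD_zero]
  | pre_add a r t E => simp [stepD_add, stepD_pre, add_smul, Pi.single_add]
  | fix E =>
    change stepD _ = stepD _
    simp only [stepD, step_toEx, step_mu]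
  | @unique E₁ E₂ h ih =>
    rw [ih, stepD_inst (EqvD.unique h)]
    simp only [stepD, step_toEx, step_mu]
  | repl E h ih => exact stepD_repl h ih E
  | pre_sum a r E₁ E₂ =>
    have : cls (add E₁ E₂) = cls E₁ + cls E₂ := rfl
    simp [stepD_add, stepD_pre, this, smul_add, Pi.single_add]
  | pre_pre a b r t E => simp [stepD_pre, ED.smul_pre]
  | pre_const a r t => simp [stepD_pre, ED.smul_const]
  | pre_nil a r => simp [stepD_pre, stepD_zero, ED.zero_eq]

/-- The underlying map of the coalgebra structure of `E_D`. -/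
noncomputable def cFun : ED R A → Fbar R A (ED R A) :=
  Quotient.lift stepD fun _ _ h => stepD_congr h

theorem cFun_cls (E : ClosedExp R A) : cFun (cls E) = stepD E := rfl

theorem cFun_add (x y : ED R A) : cFun (x + y) = cFun x + cFun y :=
  Quotient.inductionOn₂ x y stepD_add

/-- The coalgebra structure `c : E_D → F̄(E_D)`, where `c [E]` is the automaton structure `step E`
with the formal linear combinations evaluated in the semimodule `E_D`.  It is the homomorphism with
`c [s] = (s, 0)` and `c [a.(s • E)] = (0, a ↦ s[E], b ↦ 0 for b ≠ a)`; see `stepD_const` and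
`stepD_pre`. -/
noncomputable def c (R : Type u) [Semiring R] (A : Type v) : ED R A →ₗ[R] Fbar R A (ED R A) where
  toFun := cFun
  map_add' := cFun_add
  map_smul' s x := by
    classical
    induction x using ED.ind with
    | hz => exact stepD_zero.trans (smul_zero s).symm |>.trans (by rw [cFun_cls, stepD_zero]; rfl)
    | hc t => simp [ED.smul_const, cFun_cls, stepD_const]
    | hp a t E => simp [ED.smul_pre, cFun_cls, stepD_pre, mul_smul, Pi.single_smul]
    | ha x y hx hy => simp only [smul_add, cFun_add, hx, hy]

end

/-- Finitely generated `R`-semimodules are closed under kernel pairs: for every homomorphism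
`f : M → N` of finitely generated semimodules, `{(x, y) ∈ M × M | f x = f y}` is finitely
generated.  (Every finitely generated semimodule has an isomorphic copy in the universe of `R`.) -/
def FGClosedUnderKernelPairs (R : Type u) [Semiring R] : Prop :=
  ∀ (M N : Type u) [AddCommMonoid M] [Module R M] [AddCommMonoid N] [Module R N],
    Module.Finite R M → Module.Finite R N → ∀ f : M →ₗ[R] N,
      (LinearMap.eqLocus (f ∘ₗ LinearMap.fst R M M) (f ∘ₗ LinearMap.snd R M M)).FG

end WeightedCalculus

/-! A coalgebra homomorphism out of the free semimodule on `S` is the same as a solution in `E_D` of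
a finite guarded system of equations, and such a system has exactly one solution.

The reduction rests on `c` being an isomorphism with inverse `cInv`, sending `(r, (x_a))` to `r`
plus the sum of the `a.(1 • x_a)`, a finite sum because `A` is finite. Hence `m` is a homomorphism
iff `m = cInv ∘ F̄ m ∘ g`. By linearity this need only be tested on the generators, where it says
that each `m s` equals a constant plus prefixed linear combinations of the values `m t`
(`isCoalgHom_iff_apply_single`). The right-hand sides are given by guarded expressions in finitely
many variables (`isGuardedMap_linear`).

Guarded systems are solved by Gaussian elimination: `μx₀.F₀` replaces `x₀` in the other equations.
The fixpoint axiom shows that back substitution gives a solution (`exists_isSolution`), and the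
uniqueness rule forces every solution to arise in this way (`IsSolution.eqvD`). -/

namespace WeightedCalculus

open Ex

/-! ### Unique solvability of guarded systems of expressions. -/

section Systems

variable {R : Type u} {A : Type v}

/-- Eliminate the variable `0` from a guarded system by replacing it with `μx₀.F₀`. -/
def eliminate {n : ℕ} (F : Fin (n + 1) → Ex R A true (n + 1)) (i : Fin n) : Ex R A true n :=
  (F i.succ).inst (mu (F 0))

theorem eliminate_subst {n : ℕ} (F : Fin (n + 1) → Ex R A true (n + 1))
    (σ : Fin n → ClosedExp R A) (i : Fin n) :
    (eliminate F i).subst σ = (F i.succ).subst (Fin.cases ((mu (F 0)).subst σ) σ) :=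
  subst_inst _ _ _

variable [Semiring R]

/-- The replacement rule for simultaneous substitutions. -/
theorem EqvD.subst_congr {n : ℕ} {σ τ : Fin n → ClosedExp R A} (h : ∀ i, EqvD (σ i) (τ i))
    (E : Ex R A false n) : EqvD (E.subst σ) (E.subst τ) := by
  induction n with
  | zero => rw [Subsingleton.elim σ τ]; exact .refl _
  | succ n ih =>
    have head : EqvD (E.subst σ) (E.subst (Fin.cases (τ 0) fun i => σ i.succ)) := by
      -- `repl` changes one variable of a one-variable expression, so the other variables are first
      -- filled with the closed expressions `σ i.succ`.
      have h₀ := EqvD.repl (E.subst (liftSub fun i => σ i.succ)) (h 0)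
      rw [inst_subst, inst_subst] at h₀
      convert h₀ using 2
      exact (Fin.cons_self_tail σ).symm
    -- Weakening the closed `τ 0` to the scope of the other `n` variables absorbs it into the
    -- expression, which then has one variable fewer, as the induction needs.
    have tail (ρ : Fin n → ClosedExp R A) : E.subst (Fin.cases (τ 0) ρ) =
        (E.inst ((τ 0).ren Fin.elim0)).subst ρ := by
      have closed : ((τ 0).ren Fin.elim0).subst ρ = τ 0 := by
        rw [ren_subst, Subsingleton.elim (ρ ∘ Fin.elim0) var, subst_var]
      rw [subst_inst, closed]
    rw [tail] at head
    refine head.trans ?_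
    convert ih (fun i => h i.succ) (E.inst ((τ 0).ren Fin.elim0)) using 1
    rw [← tail]
    exact congrArg (fun ρ => E.subst ρ) (Fin.cons_self_tail τ).symm

theorem EqvD.subst_toEx_congr {b : Bool} {n : ℕ} {σ τ : Fin n → ClosedExp R A}
    (h : ∀ i, EqvD (σ i) (τ i)) (E : Ex R A b n) :
    EqvD (E.subst σ).toEx (E.subst τ).toEx := by
  rw [← toEx_subst, ← toEx_subst]
  exact .subst_congr h _

/-- `σ` solves the guarded system `x_i = F_i` up to `≡_D`. -/
def IsSolution {n : ℕ} (F : Fin n → Ex R A true n) (σ : Fin n → ClosedExp R A) : Prop :=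
  ∀ i, EqvD (σ i) ((F i).subst σ).toEx

/-- Back substitution: a solution of the eliminated system is extended by the value of `μx₀.F₀` at
it. The equation for `x₀` is then the fixpoint axiom, and the others are the eliminated equations.
-/
theorem exists_isSolution {n : ℕ} (F : Fin n → Ex R A true n) :
    ∃ σ : Fin n → ClosedExp R A, IsSolution F σ := by
  induction n with
  | zero => exact ⟨Fin.elim0, fun i => i.elim0⟩
  | succ n ih =>
    obtain ⟨σ, hσ⟩ := ih (eliminate F)
    refine ⟨Fin.cases ((mu (F 0)).subst σ) σ, Fin.cases ?_ fun i => ?_⟩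
    · have h := EqvD.fix ((F 0).subst (liftSub σ))
      rwa [inst_subst] at h
    · have h := hσ i
      rwa [eliminate_subst] at h

/-- With the remaining values fixed as closed parameters, the equation for `x₀` is a one-variable
guarded equation, so the uniqueness rule applies. -/
theorem IsSolution.head {n : ℕ} {F : Fin (n + 1) → Ex R A true (n + 1)}
    {σ : Fin (n + 1) → ClosedExp R A} (hσ : IsSolution F σ) :
    EqvD (σ 0) ((mu (F 0)).subst fun i => σ i.succ) := by
  refine EqvD.unique ?_
  rw [inst_subst]
  convert hσ 0 using 3
  exact Fin.cons_self_tail σ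

/-- By `IsSolution.head`, `σ 0` may be exchanged for the value of `μx₀.F₀` in the other equations.
-/
theorem IsSolution.tail {n : ℕ} {F : Fin (n + 1) → Ex R A true (n + 1)}
    {σ : Fin (n + 1) → ClosedExp R A} (hσ : IsSolution F σ) :
    IsSolution (eliminate F) fun i => σ i.succ := by
  intro i
  rw [eliminate_subst]
  exact (hσ i.succ).trans (.subst_toEx_congr (Fin.cases hσ.head fun _ => .refl _) _)

/-- The tails agree by induction on the eliminated system, and each head is determined by its tail
through `μx₀.F₀`. -/
theorem IsSolution.eqvD {n : ℕ} {F : Fin n → Ex R A true n} {σ τ : Fin n → ClosedExp R A}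
    (hσ : IsSolution F σ) (hτ : IsSolution F τ) (i : Fin n) : EqvD (σ i) (τ i) := by
  induction n with
  | zero => exact i.elim0
  | succ n ih =>
    have h := ih hσ.tail hτ.tail
    exact Fin.cases (hσ.head.trans ((EqvD.subst_congr h _).trans hτ.head.symm)) h i

end Systems

/-! ### Guarded systems in the quotient `E_D`. -/

section Representable

variable {R : Type u} [Semiring R] {A : Type v} {n : ℕ}

/-- A map on tuples of elements of `E_D` that is given by a guarded expression. -/
def IsGuardedMap (φ : (Fin n → ED R A) → ED R A) : Prop :=
  ∃ F : Ex R A true n, ∀ σ : Fin n → ClosedExp R A,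
    cls (F.subst σ).toEx = φ fun i => cls (σ i)

/-- Transfers unique solvability up to `≡_D` to honest equations between classes. -/
theorem existsUnique_of_isGuardedMap {φ : Fin n → (Fin n → ED R A) → ED R A}
    (hφ : ∀ i, IsGuardedMap (φ i)) : ∃! x : Fin n → ED R A, ∀ i, x i = φ i x := by
  choose F hF using hφ
  have solves (σ : Fin n → ClosedExp R A) :
      IsSolution F σ ↔ ∀ i, cls (σ i) = φ i fun j => cls (σ j) :=
    forall_congr' fun i => by
      rw [← hF]
      exact ⟨cls_eq, Quotient.exact⟩
  obtain ⟨σ, hσ⟩ := exists_isSolution F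
  refine ⟨fun i => cls (σ i), (solves σ).1 hσ, fun y hy => ?_⟩
  -- An arbitrary solution in the quotient is lifted to expressions by choosing representatives.
  have hy' : (fun i => cls (y i).out) = y := funext fun i => Quotient.out_eq (y i)
  have hτ : IsSolution F fun i => (y i).out := (solves _).2 fun i => by
    rw [hy']; exact (congrFun hy' i).trans (hy i)
  rw [← hy']
  exact funext fun i => cls_eq (hτ.eqvD hσ i)

theorem IsGuardedMap.zero : IsGuardedMap (0 : (Fin n → ED R A) → ED R A) :=
  ⟨.zero, fun _ => rfl⟩

theorem IsGuardedMap.add {φ ψ : (Fin n → ED R A) → ED R A} (hφ : IsGuardedMap φ)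
    (hψ : IsGuardedMap ψ) : IsGuardedMap (φ + ψ) := by
  obtain ⟨F, hF⟩ := hφ
  obtain ⟨G, hG⟩ := hψ
  refine ⟨.add F G, fun σ => ?_⟩
  rw [Pi.add_apply, ← hF, ← hG]
  rfl

theorem IsGuardedMap.sum {ι : Type*} (s : Finset ι) {φ : ι → (Fin n → ED R A) → ED R A}
    (hφ : ∀ i ∈ s, IsGuardedMap (φ i)) : IsGuardedMap (∑ i ∈ s, φ i) :=
  Finset.sum_induction _ _ (fun _ _ => IsGuardedMap.add) IsGuardedMap.zero hφ

end Representable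

/-! ### The structure map `c` is invertible; homomorphisms as solutions. -/

section FinalStructure

variable {R : Type u} [Semiring R] {A : Type v}

/-- The operation `a.(r • -)` on `E_D`. -/
def ED.pre (a : A) (r : R) : ED R A → ED R A :=
  Quotient.map (Ex.pre a r) fun _ _ h => EqvD.pre_congr a r h

theorem ED.pre_cls (a : A) (r : R) (E : ClosedExp R A) :
    ED.pre a r (cls E) = cls (Ex.pre a r E) := rfl

theorem ED.pre_add (a : A) (r : R) (x y : ED R A) :
    ED.pre a r (x + y) = ED.pre a r x + ED.pre a r y :=
  Quotient.inductionOn₂ x y fun _ _ => cls_eq (.pre_sum _ _ _ _)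

/-- Scalars pass through a prefix. The last four rules of `≡_D` say this for the zero, constants and
prefixes, and spread it over sums; `ED.ind` needs no case for `μ`, since guardedness lets it be
unfolded. -/
theorem ED.pre_eq (a : A) (r : R) (x : ED R A) : ED.pre a r x = ED.pre a 1 (r • x) := by
  induction x using ED.ind with
  | hz => exact (cls_eq (.pre_nil a r)).trans (cls_eq (.pre_nil a 1)).symm
  | hc t => exact cls_eq (.pre_const a r t)
  | hp b t E =>
    rw [ED.smul_pre, ED.pre_cls, ED.pre_cls]
    refine cls_eq ((EqvD.pre_pre a b r t E).trans (EqvD.symm ?_))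
    simpa using EqvD.pre_pre a b 1 (r * t) E
  | ha x y hx hy => rw [ED.pre_add, hx, hy, smul_add, ED.pre_add]

/-- The homomorphism `x ↦ a.(1 • x)`. -/
def ED.preHom (R : Type u) [Semiring R] {A : Type v} (a : A) : ED R A →ₗ[R] ED R A where
  toFun := ED.pre a 1
  map_add' := ED.pre_add a 1
  map_smul' r x := by
    -- After moving `r` into the prefix, what remains is the definition of the scalar action on
    -- prefixed expressions.
    rw [← ED.pre_eq, RingHom.id_apply]
    refine Quotient.inductionOn x fun E => ?_
    change cls (Ex.pre a r E) = cls (Ex.pre a (r * 1) E)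
    rw [mul_one]

theorem ED.preHom_smul_cls (a : A) (r : R) (E : ClosedExp R A) :
    ED.preHom R a (r • cls E) = cls (Ex.pre a r E) :=
  (ED.pre_eq a r (cls E)).symm

/-- The homomorphism `r ↦ [r]`. -/
def ED.constHom (R : Type u) [Semiring R] (A : Type v) : R →ₗ[R] ED R A where
  toFun r := cls (const r)
  map_add' r s := (cls_eq (EqvD.const_add r s)).symm
  map_smul' _ _ := rfl

theorem c_constHom (r : R) : c R A (ED.constHom R A r) = (r, 0) := stepD_const r

open Classical in
theorem c_preHom (a : A) (x : ED R A) : c R A (ED.preHom R a x) = (0, Pi.single a x) := by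
  refine Quotient.inductionOn x fun E => (stepD_pre a 1 E).trans ?_
  rw [one_smul]
  rfl

variable [Fintype A]

/-- The inverse of the coalgebra structure of `E_D`. -/
noncomputable def cInv (R : Type u) [Semiring R] (A : Type v) [Fintype A] : Fbar R A (ED R A) →ₗ[R] ED R A :=
  (ED.constHom R A).coprod (∑ a, ED.preHom R a ∘ₗ LinearMap.proj a)

theorem cInv_apply (x : Fbar R A (ED R A)) :
    cInv R A x = ED.constHom R A x.1 + ∑ a, ED.preHom R a (x.2 a) := by
  simp [cInv]

/-- Every expression is equivalent to its output plus the sum of its prefixed derivatives. Both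
sides are additive, so constants and prefixed expressions suffice. -/
theorem cInv_c (x : ED R A) : cInv R A (c R A x) = x := by
  classical
  induction x using ED.ind with
  | hz => exact (congrArg _ (map_zero (c R A))).trans (map_zero _)
  | hc r =>
    change cInv R A (stepD (const r)) = _
    rw [stepD_const, cInv_apply]
    simp only [Pi.zero_apply, map_zero, Finset.sum_const_zero, add_zero]
    rfl
  | hp a r E =>
    change cInv R A (stepD (Ex.pre a r E)) = _
    rw [stepD_pre, cInv_apply, map_zero, zero_add, Finset.sum_eq_single a]
    · dsimp only
      rw [Pi.single_eq_same, ED.preHom_smul_cls]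
    · intro b _ hb
      simp [Pi.single_eq_of_ne hb]
    · simp
  | ha x y hx hy => rw [map_add, map_add, hx, hy]

theorem c_cInv (x : Fbar R A (ED R A)) : c R A (cInv R A x) = x := by
  classical
  rw [cInv_apply, map_add, map_sum, c_constHom]
  simp only [c_preHom]
  refine Prod.ext ?_ (funext fun a => ?_)
  · simp [Prod.fst_sum]
  · simp [Prod.snd_sum, Finset.univ_sum_single]

/-- The right-hand side is `cInv (F̄ m (g s))`. One direction applies `cInv` to the homomorphism
equation; the other applies `c` on generators and extends by freeness. -/
theorem isCoalgHom_iff_apply_single {S : Type w} (g : (S →₀ R) →ₗ[R] Fbar R A (S →₀ R))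
    (m : (S →₀ R) →ₗ[R] ED R A) :
    IsCoalgHom g (c R A) m ↔ ∀ s, m (Finsupp.single s 1) = ED.constHom R A (g (.single s 1)).1 +
      ∑ a, ED.preHom R a (m ((g (.single s 1)).2 a)) := by
  have key (s : S) : ED.constHom R A (g (.single s 1)).1 +
      ∑ a, ED.preHom R a (m ((g (.single s 1)).2 a)) =
        cInv R A (Fbar.map A m (g (.single s 1))) := (cInv_apply (Fbar.map A m (g (.single s 1)))).symm
  simp only [key]
  constructor
  · intro h s
    rw [← LinearMap.comp_apply (Fbar.map A m), ← h, LinearMap.comp_apply, cInv_c]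
  · intro h
    refine Finsupp.lhom_ext' fun s => LinearMap.ext_ring ?_
    simp only [LinearMap.comp_apply, Finsupp.lsingle_apply]
    rw [h, c_cInv]

/-- Linearity of `ED.preHom` distributes the prefix over the sum, so that each summand becomes `a.(k
a t • x_t)`, where the variable stands under a prefix. -/
theorem isGuardedMap_linear (r : R) {n : ℕ} (k : A → Fin n → R) :
    IsGuardedMap fun x : Fin n → ED R A =>
      ED.constHom R A r + ∑ a, ED.preHom R a (∑ t, k a t • x t) := by
  have hconst : IsGuardedMap fun _ : Fin n → ED R A => ED.constHom R A r :=
    ⟨.const r, fun _ => rfl⟩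
  have hpre (a : A) (t : Fin n) :
      IsGuardedMap fun x : Fin n → ED R A => ED.preHom R a (k a t • x t) :=
    ⟨.pre a (k a t) (.var t), fun σ => (ED.preHom_smul_cls _ _ _).symm⟩
  convert hconst.add
    (IsGuardedMap.sum Finset.univ fun a _ => IsGuardedMap.sum Finset.univ fun t _ => hpre a t)
  simp [Finset.sum_apply, map_sum]

end FinalStructure

end WeightedCalculus

/-! ### The homomorphism as the solution of the system read off from `g`. -/

open WeightedCalculus in
theorem theorem5p9 {R : Type u} [Semiring R]
    (hR : WeightedCalculus.FGClosedUnderKernelPairs R)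
    {A : Type v} [Finite A] {S : Type w} [Finite S]
    (g : (S →₀ R) →ₗ[R] WeightedCalculus.Fbar R A (S →₀ R)) :
    ∃! m : (S →₀ R) →ₗ[R] WeightedCalculus.ED R A,
      WeightedCalculus.IsCoalgHom g (WeightedCalculus.c R A) m := by
  have := Fintype.ofFinite A
  have := Fintype.ofFinite S
  obtain ⟨n, ⟨e⟩⟩ := Finite.exists_equiv_fin S
  -- Transition matrices of `g` in the basis `S`, with target states numbered by `Fin n` to match
  -- the variables of the system.
  let k (s : S) (a : A) (t : Fin n) : R := (g (.single s 1)).2 a (e.symm t)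
  have lin (m : (S →₀ R) →ₗ[R] ED R A) (s : S) (a : A) :
      m ((g (.single s 1)).2 a) = ∑ t, k s a t • m (.single (e.symm t) 1) := by
    rw [e.symm.sum_comp fun t => (g (.single s 1)).2 a t • m (.single t 1)]
    conv_lhs => rw [← Finsupp.univ_sum_single ((g (.single s 1)).2 a), map_sum]
    refine Finset.sum_congr rfl fun t _ => ?_
    rw [← map_smul, Finsupp.smul_single_one]
  obtain ⟨x, hx, hu⟩ := existsUnique_of_isGuardedMap fun i : Fin n =>
    isGuardedMap_linear (g (.single (e.symm i) 1)).1 (k (e.symm i))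
  -- Being a homomorphism means that the tuple of values on generators solves the system, hence is
  -- its unique solution `x`.
  have hom_iff (m : (S →₀ R) →ₗ[R] ED R A) : IsCoalgHom g (c R A) m ↔
      (fun i => m (.single (e.symm i) 1)) = x := by
    rw [isCoalgHom_iff_apply_single, ← e.symm.forall_congr_right]
    simp only [lin]
    exact ⟨hu _, fun h => by subst h; exact hx⟩
  -- The linear extension of `x` takes the required values on generators, and a linear map on a free
  -- semimodule is determined by those values.
  refine ⟨Finsupp.linearCombination R (x ∘ e), (hom_iff _).2 ?_, fun m hm => ?_⟩
  · simp
  · refine Finsupp.lhom_ext' fun s => LinearMap.ext_ring ?_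
    simpa using congrFun ((hom_iff m).1 hm) (e s)
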